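/- Let $\lambda_R,\lambda_S\ge 0$. Let $\Psi$ be a Poisson line process in $\mathbb{R}^2$ of intensity $\lambda_R$: writing each line uniquely as $\ell_{\theta,p}=\{(x_1,x_2): x_1\cos\theta+x_2\sin\theta=p\}$ with $(\theta,p)\in[0,\pi)\times\mathbb{R}$, the parameters of the lines form a Poisson point process on $[0,\pi)\times\mathbb{R}$ with intensity measure $\lambda_R\,d\theta\,dp$ (so the number of lines hitting a disk of radius $x$ is Poisson with mean $2\pi\lambda_R x$). Let $\phi_S$ be the Poisson line Cox process on $\Psi$: conditionally on $\Psi$, $\phi_S$ is a Poisson point process in $\mathbb{R}^2$ with intensity measure $\lambda_S\sum_{\ell\in\Psi}\mathrm{length}(\ell\cap\cdot)$, that is, the points form independent homogeneous linear Poisson processes of intensity $\lambda_S$ on the lines of $\Psi$. Then for every Borel function $\nu$ with $0\le\nu(r)\le 1$ for all $r\ge 0$, the random variable $\prod_{x\in\phi_S}\nu(\|x\|)$ (the unordered product, which always converges) is integrable, and the probability generating functional of $\phi_S$ at the radially symmetric function $x\mapsto\nu(\|x\|)$ is $$G_{\phi_S}(\nu)=\mathbb{E}\Big[\prod_{x\in\phi_S}\nu(\|x\|)\Big]=\exp\left(-2\pi\lambda_R\int_0^\infty\left[1-\exp\left(-2\lambda_S\int_0^\infty\big(1-\nu(\sqrt{r^2+t^2})\big)\,dt\right)\right]dr\right),$$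 where the integrals of nonnegative functions may be $+\infty$, $\exp(-\infty)=0$ and $0\cdot\infty=0$. -/

import Mathlib

open MeasureTheory ProbabilityTheory Set
open scoped ENNReal NNReal

namespace LineCox

noncomputable section

/-- The Euclidean plane. -/
abbrev Plane : Type := EuclideanSpace ℝ (Fin 2)

/-- The number of points of the configuration `S` in `B` (only used when `S ∩ B` is finite). -/
def count {E : Type*} (S B : Set E) : ℕ := (S ∩ B).ncard

/-- The probability of the value `k` under the Poisson law of mean `a ∈ [0, ∞]`; under an infinite
mean the count is almost surely infinite, so every `k : ℕ` has probability `0`. -/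
def poissonProb (a : ℝ≥0∞) (k : ℕ) : ℝ :=
  if a = ∞ then 0 else (poissonMeasure a.toNNReal).real {k}

/-- A (simple) point process: a random locally finite set of points whose numbers of points in
bounded Borel sets are random variables. -/
structure IsPointProcess {Ω E : Type*} [MeasurableSpace Ω] [PseudoMetricSpace E]
    [MeasurableSpace E] (X : Ω → Set E) : Prop where
  locallyFinite : ∀ ω, ∀ B : Set E, Bornology.IsBounded B → (X ω ∩ B).Finite
  measurable_count : ∀ B : Set E, MeasurableSet B → Bornology.IsBounded B →
    Measurable fun ω => count (X ω) B

/-- The σ-algebra generated by a point process. -/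
@[reducible] def generatedBy {Ω E : Type*} [PseudoMetricSpace E] [MeasurableSpace E] (X : Ω → Set E) :
    MeasurableSpace Ω :=
  ⨆ (B : Set E) (_ : MeasurableSet B) (_ : Bornology.IsBounded B),
    MeasurableSpace.comap (fun ω => count (X ω) B) ⊤

/-- `X` is a Poisson point process with intensity measure `M`: the numbers of points in disjoint
bounded Borel sets `B i` are independent Poisson variables with means `M (B i)`. -/
structure IsPoissonProcess {Ω E : Type*} [MeasurableSpace Ω] [PseudoMetricSpace E]
    [MeasurableSpace E] (P : Measure Ω) (X : Ω → Set E) (M : Measure E) : Prop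
    extends IsPointProcess X where
  law : ∀ (n : ℕ) (B : Fin n → Set E), (∀ i, MeasurableSet (B i)) →
    (∀ i, Bornology.IsBounded (B i)) → Pairwise (Function.onFun Disjoint B) →
    ∀ k : Fin n → ℕ,
      P.real {ω | ∀ i, count (X ω) (B i) = k i} = ∏ i, poissonProb (M (B i)) (k i)

/-- `X` is, conditionally on the σ-algebra `m`, a Poisson point process with the (random) intensity
measure `M`: it is a Cox process driven by `M`. -/
structure IsCoxProcess {Ω E : Type*} (m : MeasurableSpace Ω) [m0 : MeasurableSpace Ω]
    [PseudoMetricSpace E] [MeasurableSpace E] (P : Measure[m0] Ω) (X : Ω → Set E)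
    (M : Ω → Measure E) : Prop
    extends IsPointProcess X where
  condLaw : ∀ (n : ℕ) (B : Fin n → Set E), (∀ i, MeasurableSet (B i)) →
    (∀ i, Bornology.IsBounded (B i)) → Pairwise (Function.onFun Disjoint B) →
    ∀ k : Fin n → ℕ,
      P⟦{ω | ∀ i, count (X ω) (B i) = k i} | m⟧
        =ᵐ[P] fun ω => ∏ i, poissonProb (M ω (B i)) (k i)

/-- The unit-speed parametrization of the line `{x | x₀ cos θ + x₁ sin θ = p}`, `ℓ = (θ, p)`. -/
def linePoint (ℓ : ℝ × ℝ) (t : ℝ) : Plane :=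
  !₂[ℓ.2 * Real.cos ℓ.1 - t * Real.sin ℓ.1, ℓ.2 * Real.sin ℓ.1 + t * Real.cos ℓ.1]

/-- The length measure on the line with parameters `ℓ`. -/
def lengthMeasure (ℓ : ℝ × ℝ) : Measure Plane := Measure.map (linePoint ℓ) volume

/-- A Poisson line process of intensity `lamR`: every line of the plane is given by exactly one
`(θ, p) ∈ [0, π) × ℝ`, and the parameters of the lines form a Poisson point process on
`[0, π) × ℝ` with intensity `lamR dθ dp`. -/
def IsPoissonLineProcess {Ω : Type*} [MeasurableSpace Ω] (P : Measure Ω)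
    (R : Ω → Set (ℝ × ℝ)) (lamR : ℝ≥0) : Prop :=
  IsPoissonProcess P R (lamR • (volume : Measure (ℝ × ℝ)).restrict (Ico 0 Real.pi ×ˢ univ))

/-- `S` is the Poisson line Cox process on the line process `R`: given the lines, it is a Poisson
point process whose intensity measure is `lamS` times the sum of the length measures on the lines
(independent linear Poisson processes of intensity `lamS`, one on each line). -/
def IsPoissonOnLines {Ω : Type*} [MeasurableSpace Ω] (P : Measure Ω)
    (R : Ω → Set (ℝ × ℝ)) (S : Ω → Set Plane) (lamS : ℝ≥0) : Prop :=
  IsCoxProcess (generatedBy R) P S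
    fun ω => lamS • Measure.sum fun ℓ : R ω => lengthMeasure (ℓ : ℝ × ℝ)

/-- The product of `v` over all points of a configuration. For `v` with values in `[0, 1]` the
unordered product always converges, see `multipliable_of_mem_Icc`. -/
def pointProduct {E : Type*} (v : E → ℝ) (X : Set E) : ℝ := ∏' x : X, v x

/-- The probability generating functional `E [∏_{x ∈ X} v x]`. -/
def pgf {Ω E : Type*} [MeasurableSpace Ω] (P : Measure Ω) (X : Ω → Set E) (v : E → ℝ) : ℝ :=
  ∫ ω, pointProduct v (X ω) ∂P

/-- `exp (-a)` for `a ∈ [0, ∞]`, with `exp (-∞) = 0`. -/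
def expNeg (a : ℝ≥0∞) : ℝ := if a = ∞ then 0 else Real.exp (-a.toReal)

theorem multipliable_of_mem_Icc {E : Type*} (v : E → ℝ) (X : Set E)
    (h : ∀ x, v x ∈ Icc (0 : ℝ) 1) : Multipliable fun x : X => v x := by
  refine ⟨⨅ s : Finset X, ∏ x ∈ s, v x, ?_⟩
  refine tendsto_atTop_ciInf (fun s t hst => ?_) ⟨0, ?_⟩
  · exact Finset.prod_le_prod_of_subset_of_le_one hst (fun x _ => (h x).1) (fun x _ _ => (h x).2)
  · rintro _ ⟨s, rfl⟩
    exact Finset.prod_nonneg fun x _ => (h x).1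

theorem continuous_linePoint (ℓ : ℝ × ℝ) : Continuous (linePoint ℓ) := by
  unfold linePoint
  fun_prop

end

end LineCox

namespace LineCox

section

open Filter Topology

/-! ### The function `expNeg` -/

/-! The generating functional of a Cox process directed by a random measure `M` is the mean of `exp
(-∫ (1 - v) dM)`, and this identity is used twice. For the points, `M` is a sum over the lines, so
the exponential factors into a product over the line process of a function of `p` alone. Its mean is
the generating functional of the line process, where the same identity applies with a deterministic
measure. Integrating out the angle and using evenness in `t` and `p` gives the constants.

The identity itself (`IsMixedPoisson.integrable_and_pgf_eq`) is first proved when `1 - v` is simple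
with bounded support: the product is then a monomial in finitely many counts, and
`tsum_prod_poissonProb` sums the Poisson series. The general case follows by monotone approximation
and dominated convergence. -/

theorem expNeg_eq_toReal_exp (a : ℝ≥0∞) : expNeg a = (EReal.exp (-(a : EReal))).toReal := by
  induction a with
  | top => simp [expNeg]
  | coe a =>
    have : (-((a : ℝ≥0∞) : EReal)) = ((-(a : ℝ) : ℝ) : EReal) := by
      rw [EReal.coe_neg]
      rfl
    rw [this, EReal.exp_coe, ENNReal.toReal_ofReal (Real.exp_pos _).le]
    simp [expNeg]

/-- Continuity includes the point `∞`, so `expNeg` passes through infinite sums and monotone limits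
of integrals with no finiteness assumption. -/
theorem continuous_expNeg : Continuous expNeg := by
  have h : Continuous fun a : ℝ≥0∞ => EReal.exp (-(a : EReal)) :=
    ENNReal.continuous_exp.comp (continuous_neg.comp continuous_coe_ennreal_ereal)
  rw [funext expNeg_eq_toReal_exp]
  refine ENNReal.continuousOn_toReal.comp_continuous h fun a => ?_
  simp [EReal.exp_eq_top_iff]

theorem expNeg_zero : expNeg 0 = 1 := by simp [expNeg]

theorem expNeg_coe (a : ℝ≥0) : expNeg a = Real.exp (-a) := by simp [expNeg]

theorem expNeg_mem_Icc (a : ℝ≥0∞) : expNeg a ∈ Icc (0 : ℝ) 1 := by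
  unfold expNeg
  split_ifs
  · simp
  · exact ⟨(Real.exp_pos _).le, Real.exp_le_one_iff.2 (by simp)⟩

theorem expNeg_add (a b : ℝ≥0∞) : expNeg (a + b) = expNeg a * expNeg b := by
  induction a with
  | top => simp [expNeg]
  | coe a =>
    induction b with
    | top => simp [expNeg]
    | coe b =>
      rw [← ENNReal.coe_add, expNeg_coe, expNeg_coe, expNeg_coe, ← Real.exp_add]
      push_cast
      ring_nf

theorem expNeg_sum {ι : Type*} (s : Finset ι) (a : ι → ℝ≥0∞) :
    expNeg (∑ i ∈ s, a i) = ∏ i ∈ s, expNeg (a i) := by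
  classical
  induction s using Finset.induction_on with
  | empty => simp [expNeg_zero]
  | insert i s hi ih => rw [Finset.sum_insert hi, Finset.prod_insert hi, expNeg_add, ih]

theorem expNeg_tsum {ι : Type*} (a : ι → ℝ≥0∞) : expNeg (∑' i, a i) = ∏' i, expNeg (a i) := by
  have h : HasProd (fun i => expNeg (a i)) (expNeg (∑' i, a i)) := by
    have := (continuous_expNeg.tendsto _).comp (ENNReal.summable (f := a)).hasSum
    refine this.congr fun s => ?_
    simp [expNeg_sum]
  exact h.tprod_eq.symm

/-! ### Sums of Poisson probabilities -/

theorem integral_pow_poissonMeasure (a : ℝ≥0) (c : ℝ) :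
    ∫ k, c ^ k ∂(poissonMeasure a) = Real.exp (-((1 - c) * a)) := by
  rw [integral_poissonMeasure]
  have h := (NormedSpace.expSeries_div_hasSum_exp ((a : ℝ) * c)).mul_left (Real.exp (-a))
  rw [← Real.exp_eq_exp_ℝ, ← Real.exp_add] at h
  convert h.tsum_eq using 1
  · congr 1
    ext n
    simp only [smul_eq_mul, mul_pow]
    ring
  · ring_nf

theorem poissonProb_nonneg (a : ℝ≥0∞) (k : ℕ) : 0 ≤ poissonProb a k := by
  unfold poissonProb
  split_ifs <;> simp

/-- For finite means this is Fubini for the product of the Poisson laws. If some `a i = ∞`, both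
sides vanish; this needs `d i ≠ 0`, since `0 * ∞ = 0` would make that factor on the right equal to
`1`. -/
theorem tsum_prod_poissonProb {n : ℕ} (a d : Fin n → ℝ≥0∞) (hd0 : ∀ i, d i ≠ 0)
    (hd1 : ∀ i, d i ≤ 1) :
    ∑' k : Fin n → ℕ, (∏ i, (1 - (d i).toReal) ^ k i) * ∏ i, poissonProb (a i) (k i) =
      expNeg (∑ i, d i * a i) := by
  by_cases ha : ∃ i, a i = ∞
  · obtain ⟨i, hi⟩ := ha
    have h1 : ∀ k : Fin n → ℕ, ∏ i, poissonProb (a i) (k i) = 0 := fun k =>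
      Finset.prod_eq_zero (Finset.mem_univ i) (by simp [poissonProb, hi])
    have h2 : expNeg (d i * a i) = 0 := by simp [hi, ENNReal.mul_top (hd0 i), expNeg]
    simp_rw [h1, mul_zero, tsum_zero, expNeg_sum]
    exact (Finset.prod_eq_zero (Finset.mem_univ i) h2).symm
  · push Not at ha
    lift a to Fin n → ℝ≥0 using ha
    have hd : ∀ i, d i ≠ ∞ := fun i => ((hd1 i).trans_lt ENNReal.one_lt_top).ne
    lift d to Fin n → ℝ≥0 using hd
    have hd1' : ∀ i, (d i : ℝ) ≤ 1 := fun i => by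
      have h := hd1 i
      simp only [ENNReal.coe_le_one_iff] at h
      exact_mod_cast h
    have key := integral_fintype_prod_eq_prod (𝕜 := ℝ) (μ := fun i => poissonMeasure (a i))
      (f := fun i k => (1 - (d i : ℝ)) ^ k)
    have hint : Integrable (fun k : Fin n → ℕ => ∏ i, (1 - (d i : ℝ)) ^ k i)
        (Measure.pi fun i => poissonMeasure (a i)) := by
      refine Integrable.of_bound (C := 1) .of_discrete (ae_of_all _ fun k => ?_)
      rw [norm_prod]
      refine Finset.prod_le_one (fun _ _ => norm_nonneg _) fun i _ => ?_
      rw [norm_pow]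
      refine pow_le_one₀ (norm_nonneg _) ?_
      rw [Real.norm_eq_abs, abs_le]
      constructor <;> linarith [hd1' i, (d i).coe_nonneg]
    rw [integral_countable hint] at key
    simp only [integral_pow_poissonMeasure, sub_sub_cancel] at key
    rw [expNeg_sum]
    simp_rw [← ENNReal.coe_mul, expNeg_coe, NNReal.coe_mul]
    rw [← key]
    congr 1
    ext k
    simp only [ENNReal.coe_toReal, poissonProb, ENNReal.coe_ne_top, if_false,
      ENNReal.toNNReal_coe, smul_eq_mul, measureReal_def, Measure.pi_singleton,
      ENNReal.toReal_prod]
    rw [mul_comm]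

/-! ### Products over configurations -/

theorem pointProduct_eq_iInf {E : Type*} {v : E → ℝ} {X : Set E} (h : ∀ x, v x ∈ Icc (0 : ℝ) 1) :
    pointProduct v X = ⨅ s : Finset X, ∏ x ∈ s, v x := by
  refine HasProd.tprod_eq ?_
  refine tendsto_atTop_ciInf (fun s t hst => ?_) ⟨0, ?_⟩
  · exact Finset.prod_le_prod_of_subset_of_le_one hst (fun x _ => (h x).1) (fun x _ _ => (h x).2)
  · rintro _ ⟨s, rfl⟩
    exact Finset.prod_nonneg fun x _ => (h x).1

theorem pointProduct_le_prod {E : Type*} {v : E → ℝ} {X : Set E} (h : ∀ x, v x ∈ Icc (0 : ℝ) 1)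
    (s : Finset X) : pointProduct v X ≤ ∏ x ∈ s, v x := by
  rw [pointProduct_eq_iInf h]
  refine ciInf_le ⟨0, ?_⟩ s
  rintro _ ⟨s, rfl⟩
  exact Finset.prod_nonneg fun x _ => (h x).1

theorem pointProduct_mem_Icc {E : Type*} {v : E → ℝ} (X : Set E)
    (h : ∀ x, v x ∈ Icc (0 : ℝ) 1) : pointProduct v X ∈ Icc (0 : ℝ) 1 := by
  refine ⟨?_, by simpa using pointProduct_le_prod (X := X) h ∅⟩
  rw [pointProduct_eq_iInf h]
  exact le_ciInf fun s => Finset.prod_nonneg fun x _ => (h x).1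

theorem pointProduct_mono {E : Type*} {v w : E → ℝ} (X : Set E) (hv : ∀ x, v x ∈ Icc (0 : ℝ) 1)
    (hw : ∀ x, w x ∈ Icc (0 : ℝ) 1) (h : ∀ x, v x ≤ w x) :
    pointProduct v X ≤ pointProduct w X := by
  rw [pointProduct_eq_iInf hw]
  exact le_ciInf fun s => (pointProduct_le_prod hv s).trans
    (Finset.prod_le_prod (fun x _ => (hv x).1) fun x _ => h x)

/-- Monotonicity bounds the products from below by the limit. From above, each is at most a finite
subproduct, and some finite subproduct of `w` is as close to the infimum as desired. -/
theorem tendsto_pointProduct {E : Type*} {v : ℕ → E → ℝ} {w : E → ℝ} (X : Set E)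
    (hv : ∀ n x, v n x ∈ Icc (0 : ℝ) 1) (hw : ∀ x, w x ∈ Icc (0 : ℝ) 1)
    (hle : ∀ n x, w x ≤ v n x) (hlim : ∀ x, Tendsto (fun n => v n x) atTop (𝓝 (w x))) :
    Tendsto (fun n => pointProduct (v n) X) atTop (𝓝 (pointProduct w X)) := by
  refine tendsto_order.2 ⟨fun b hb => Eventually.of_forall fun n =>
    hb.trans_le (pointProduct_mono X hw (hv n) (hle n)), fun b hb => ?_⟩
  rw [pointProduct_eq_iInf hw] at hb
  obtain ⟨s, hs⟩ := exists_lt_of_ciInf_lt hb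
  have := tendsto_finsetProd s fun (x : X) _ => hlim x
  filter_upwards [this.eventually_lt_const hs] with n hn
  exact (pointProduct_le_prod (hv n) s).trans_lt hn

/-- Points are grouped by the value of `f`. The value `0` contributes factors `1` and is left out,
as its level set may contain infinitely many points. -/
theorem pointProduct_simpleFunc {E : Type*} [MeasurableSpace E] (f : SimpleFunc E ℝ≥0∞) {X : Set E}
    (hX : (X ∩ Function.support f).Finite) :
    pointProduct (fun x => 1 - (f x).toReal) X =
      ∏ c ∈ f.range with c ≠ 0, (1 - c.toReal) ^ count X (f ⁻¹' {c}) := by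
  classical
  have h1 : pointProduct (fun x => 1 - (f x).toReal) X =
      ∏ x ∈ hX.toFinset, (1 - (f x).toReal) := by
    rw [pointProduct, tprod_subtype X fun x => 1 - (f x).toReal, tprod_eq_prod (s := hX.toFinset)]
    · refine Finset.prod_congr rfl fun x hx => mulIndicator_of_mem ?_ _
      exact ((Finite.mem_toFinset _).1 hx).1
    · intro x hx
      by_cases hxX : x ∈ X
      · have : f x = 0 := by simpa [hxX] using hx
        simp [hxX, this]
      · simp [hxX]
  rw [h1, ← Finset.prod_fiberwise_of_maps_to' (g := f) (t := {c ∈ f.range | c ≠ 0})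
    (f := fun c => 1 - c.toReal)]
  · refine Finset.prod_congr rfl fun c hc => ?_
    rw [Finset.prod_const]
    congr 1
    rw [count, ← Set.ncard_coe_finset]
    congr 1
    ext x
    have hc0 : c ≠ 0 := (Finset.mem_filter.1 hc).2
    simp only [Finset.coe_filter, Finite.mem_toFinset, mem_inter_iff, Function.mem_support,
      mem_ofPred_eq, mem_preimage, mem_singleton_iff]
    constructor
    · rintro ⟨⟨h, -⟩, h'⟩
      exact ⟨h, h'⟩
    · rintro ⟨h, rfl⟩
      exact ⟨⟨h, hc0⟩, rfl⟩
  · intro x hx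
    have := ((Finite.mem_toFinset _).1 hx).2
    simpa using this

/-- The joint laws of the counts of `X` are mixtures of products of Poisson laws, directed by the
random measure `M`. -/
structure IsMixedPoisson {Ω E : Type*} [MeasurableSpace Ω] [PseudoMetricSpace E]
    [MeasurableSpace E] (P : Measure Ω) (X : Ω → Set E) (M : Ω → Measure E) : Prop
    extends IsPointProcess X where
  integrable : ∀ (n : ℕ) (B : Fin n → Set E), (∀ i, MeasurableSet (B i)) →
    (∀ i, Bornology.IsBounded (B i)) → Pairwise (Function.onFun Disjoint B) →
    ∀ k : Fin n → ℕ, Integrable (fun ω => ∏ i, poissonProb (M ω (B i)) (k i)) P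
  law : ∀ (n : ℕ) (B : Fin n → Set E), (∀ i, MeasurableSet (B i)) →
    (∀ i, Bornology.IsBounded (B i)) → Pairwise (Function.onFun Disjoint B) →
    ∀ k : Fin n → ℕ,
      P.real {ω | ∀ i, count (X ω) (B i) = k i} = ∫ ω, ∏ i, poissonProb (M ω (B i)) (k i) ∂P

/-! ### Counts of mixed Poisson processes -/

section

variable {Ω E : Type*} [MeasurableSpace Ω] [PseudoMetricSpace E] [MeasurableSpace E]
  {P : Measure Ω} {X : Ω → Set E}

theorem IsPoissonProcess.isMixedPoisson [IsProbabilityMeasure P] {M : Measure E}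
    (h : IsPoissonProcess P X M) :
    IsMixedPoisson P X fun _ => M where
  __ := h
  integrable _ _ _ _ _ _ := integrable_const _
  law n B hB hb hd k := by simpa using h.law n B hB hb hd k

theorem IsPointProcess.measurable_counts (h : IsPointProcess X) {n : ℕ} {B : Fin n → Set E}
    (hB : ∀ i, MeasurableSet (B i)) (hb : ∀ i, Bornology.IsBounded (B i)) :
    Measurable fun ω i => count (X ω) (B i) :=
  measurable_pi_lambda _ fun i => h.measurable_count (B i) (hB i) (hb i)

theorem IsPointProcess.measurableSet_counts (h : IsPointProcess X) {n : ℕ} {B : Fin n → Set E}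
    (hB : ∀ i, MeasurableSet (B i)) (hb : ∀ i, Bornology.IsBounded (B i)) (k : Fin n → ℕ) :
    MeasurableSet {ω | ∀ i, count (X ω) (B i) = k i} := by
  convert h.measurable_counts hB hb (measurableSet_singleton k) using 1
  ext ω
  simp [funext_iff]

theorem IsPointProcess.generatedBy_le (h : IsPointProcess X) : generatedBy X ≤ ‹_› :=
  iSup_le fun B => iSup_le fun hB => iSup_le fun hb => (h.measurable_count B hB hb).comap_le

namespace IsMixedPoisson

variable {M : Ω → Measure E}

/-- Measurability of the directing measure is recovered from the void probability `k = 0`, which is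
`expNeg (M ω B)`, by taking a logarithm. -/
theorem aemeasurable_measure (h : IsMixedPoisson P X M) {B : Set E}
    (hB : MeasurableSet B) (hb : Bornology.IsBounded B) : AEMeasurable (fun ω => M ω B) P := by
  have h1 : AEMeasurable (fun ω => expNeg (M ω B)) P := by
    refine (h.integrable 1 (fun _ => B) (fun _ => hB) (fun _ => hb)
      (fun i j hij => (hij (Subsingleton.elim i j)).elim) 0).aestronglyMeasurable.aemeasurable.congr
        (ae_of_all _ fun ω => ?_)
    simp [poissonProb, expNeg, poissonMeasure_real_singleton]
    rfl
  have h2 : Measurable fun r : ℝ => if r = 0 then ∞ else ENNReal.ofReal (-Real.log r) :=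
    Measurable.ite (measurableSet_singleton 0) measurable_const (by fun_prop)
  refine (h2.comp_aemeasurable h1).congr (ae_of_all _ fun ω => ?_)
  by_cases hω : M ω B = ∞
  · simp [expNeg, hω]
  · simp [expNeg, hω, Real.exp_ne_zero]

variable [IsProbabilityMeasure P]

theorem integral_prod_pow_count (h : IsMixedPoisson P X M) {n : ℕ} {B : Fin n → Set E}
    (hB : ∀ i, MeasurableSet (B i)) (hb : ∀ i, Bornology.IsBounded (B i))
    (hd : Pairwise (Function.onFun Disjoint B)) {d : Fin n → ℝ≥0∞} (hd0 : ∀ i, d i ≠ 0)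
    (hd1 : ∀ i, d i ≤ 1) :
    ∫ ω, ∏ i, (1 - (d i).toReal) ^ count (X ω) (B i) ∂P =
      ∫ ω, expNeg (∑ i, d i * M ω (B i)) ∂P := by
  have hN := h.measurable_counts hB hb
  set N : Ω → Fin n → ℕ := fun ω i => count (X ω) (B i) with hNdef
  have hP : IsProbabilityMeasure (P.map N) := Measure.isProbabilityMeasure_map hN.aemeasurable
  have hc : ∀ i, 1 - (d i).toReal ∈ Icc (0 : ℝ) 1 := fun i => by
    have := ENNReal.toReal_mono ENNReal.one_ne_top (hd1 i)
    rw [ENNReal.toReal_one] at this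
    exact ⟨by linarith, by linarith [(d i).toReal_nonneg]⟩
  set F : (Fin n → ℕ) → ℝ := fun k => ∏ i, (1 - (d i).toReal) ^ k i with hF
  have hF01 : ∀ k, F k ∈ Icc (0 : ℝ) 1 := fun k =>
    ⟨Finset.prod_nonneg fun i _ => pow_nonneg (hc i).1 _,
      Finset.prod_le_one (fun i _ => pow_nonneg (hc i).1 _)
        fun i _ => pow_le_one₀ (hc i).1 (hc i).2⟩
  have hFint : Integrable F (P.map N) :=
    Integrable.of_bound (C := 1) .of_discrete (ae_of_all _ fun k => by
      rw [Real.norm_of_nonneg (hF01 k).1]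
      exact (hF01 k).2)
  have hlaw : ∀ k, (P.map N).real {k} = ∫ ω, ∏ i, poissonProb (M ω (B i)) (k i) ∂P := fun k => by
    rw [← h.law n B hB hb hd k, map_measureReal_apply hN (measurableSet_singleton k)]
    congr 1
    ext ω
    simp [hNdef, funext_iff]
  have hsum : Summable fun k => (P.map N).real {k} := by
    refine ENNReal.summable_toReal ?_
    have := lintegral_countable' (μ := P.map N) fun _ => 1
    simp only [lintegral_const, measure_univ, one_mul] at this
    exact this ▸ ENNReal.one_ne_top
  have h1 : ∫ ω, F (N ω) ∂P = ∑' k, F k * (P.map N).real {k} := by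
    rw [← integral_map hN.aemeasurable hFint.aestronglyMeasurable, integral_countable hFint]
    simp [mul_comm]
  have hprod : ∀ (ω : Ω) (k : Fin n → ℕ), 0 ≤ ∏ i, poissonProb (M ω (B i)) (k i) := fun ω k =>
    Finset.prod_nonneg fun i _ => poissonProb_nonneg _ _
  change ∫ ω, F (N ω) ∂P = _
  rw [h1]
  simp_rw [fun ω => (tsum_prod_poissonProb (fun i => M ω (B i)) d hd0 hd1).symm]
  -- Sum and integral may be exchanged because `0 ≤ F ≤ 1`: the `k`-th term has norm integral at
  -- most `P (N = k)`, which is summable.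
  rw [← integral_tsum_of_summable_integral_norm]
  · simp_rw [integral_const_mul, ← hlaw]
    rfl
  · exact fun k => (h.integrable n B hB hb hd k).const_mul (F k)
  · refine hsum.of_nonneg_of_le (fun k => integral_nonneg fun ω => norm_nonneg _) fun k => ?_
    rw [hlaw k]
    refine integral_mono ((h.integrable n B hB hb hd k).const_mul (F k)).norm
      (h.integrable n B hB hb hd k) fun ω => ?_
    change ‖F k * ∏ i, poissonProb (M ω (B i)) (k i)‖ ≤ _
    rw [Real.norm_of_nonneg (mul_nonneg (hF01 k).1 (hprod ω k))]
    exact mul_le_of_le_one_left (hprod ω k) (hF01 k).2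

end IsMixedPoisson

end

/-- Taking expectations of the conditional law is enough: the generating functional depends only on
the unconditional joint laws of the counts. -/
theorem IsCoxProcess.isMixedPoisson {Ω E : Type*} {m : MeasurableSpace Ω}
    [m0 : MeasurableSpace Ω] [PseudoMetricSpace E] [MeasurableSpace E] {P : Measure[m0] Ω}
    [IsProbabilityMeasure P] {X : Ω → Set E} {M : Ω → Measure E}
    (hm : m ≤ m0) (h : IsCoxProcess m P X M) : IsMixedPoisson P X M where
  __ := h
  integrable n B hB hb hd k := integrable_condExp.congr (h.condLaw n B hB hb hd k)
  law n B hB hb hd k := by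
    rw [← integral_congr_ae (h.condLaw n B hB hb hd k), integral_condExp hm,
      integral_indicator (h.measurableSet_counts hB hb k)]
    simp

/-! ### The generating functional of a mixed Poisson process -/

namespace IsMixedPoisson

variable {Ω E : Type*} [MeasurableSpace Ω] [PseudoMetricSpace E] [MeasurableSpace E]
  {P : Measure Ω} [IsProbabilityMeasure P] {X : Ω → Set E} {M : Ω → Measure E}

theorem pgf_simpleFunc (h : IsMixedPoisson P X M) (f : SimpleFunc E ℝ≥0∞)
    (hf : ∀ x, f x ≤ 1) (hb : Bornology.IsBounded (Function.support f)) :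
    AEStronglyMeasurable (fun ω => pointProduct (fun x => 1 - (f x).toReal) (X ω)) P ∧
    AEStronglyMeasurable (fun ω => expNeg (∫⁻ x, f x ∂(M ω))) P ∧
    pgf P X (fun x => 1 - (f x).toReal) = ∫ ω, expNeg (∫⁻ x, f x ∂(M ω)) ∂P := by
  classical
  set s : Finset ℝ≥0∞ := {c ∈ f.range | c ≠ 0} with hs
  have hs0 : ∀ c ∈ s, c ≠ 0 := fun c hc => (Finset.mem_filter.1 hc).2
  have hs1 : ∀ c ∈ s, c ≤ 1 := fun c hc => by
    obtain ⟨x, rfl⟩ := SimpleFunc.mem_range.1 (Finset.mem_filter.1 hc).1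
    exact hf x
  have hBm : ∀ c, MeasurableSet (f ⁻¹' {c}) := fun c => f.measurableSet_fiber c
  have hBb : ∀ c ∈ s, Bornology.IsBounded (f ⁻¹' {c}) := fun c hc => hb.subset fun x hx => by
    rw [Function.mem_support, show f x = c from hx]
    exact hs0 c hc
  have hpp : ∀ ω, pointProduct (fun x => 1 - (f x).toReal) (X ω) =
      ∏ c ∈ s, (1 - c.toReal) ^ count (X ω) (f ⁻¹' {c}) := fun ω =>
    pointProduct_simpleFunc f (h.locallyFinite ω _ hb)
  have hint : ∀ ω, ∫⁻ x, f x ∂(M ω) = ∑ c ∈ s, c * M ω (f ⁻¹' {c}) := fun ω => by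
    rw [SimpleFunc.lintegral_eq_lintegral, SimpleFunc.lintegral, hs, Finset.sum_filter]
    refine Finset.sum_congr rfl fun c _ => ?_
    split_ifs with hc
    · rfl
    · rw [not_not.1 hc, zero_mul]
  refine ⟨?_, ?_, ?_⟩
  · simp_rw [hpp]
    refine (Finset.measurable_fun_prod _ fun c hc => ?_).aestronglyMeasurable
    exact (measurable_from_top (f := fun k : ℕ => (1 - c.toReal) ^ k)).comp
      (h.measurable_count _ (hBm c) (hBb c hc))
  · simp_rw [hint]
    refine (continuous_expNeg.measurable.comp_aemeasurable
      (Finset.aemeasurable_fun_sum _ fun c hc => ?_)).aestronglyMeasurable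
    exact (h.aemeasurable_measure (hBm c) (hBb c hc)).const_mul c
  -- The nonzero values are indexed by `Fin`, as in the laws of the counts; their level sets are
  -- disjoint and bounded.
  · let e := s.equivFin
    have h1 : ∀ g : ℝ≥0∞ → ℝ, ∏ c ∈ s, g c = ∏ i, g (e.symm i) := fun g => by
      rw [← Finset.prod_coe_sort, e.symm.prod_comp fun c : s => g c]
    have h2 : ∀ g : ℝ≥0∞ → ℝ≥0∞, ∑ c ∈ s, g c = ∑ i, g (e.symm i) := fun g => by
      rw [← Finset.sum_coe_sort, e.symm.sum_comp fun c : s => g c]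
    simp_rw [pgf, hpp, hint, h1, h2]
    refine h.integral_prod_pow_count (fun i => hBm _) (fun i => hBb _ (e.symm i).2) ?_
      (fun i => hs0 _ (e.symm i).2) fun i => hs1 _ (e.symm i).2
    intro i j hij
    refine Disjoint.preimage _ (disjoint_singleton.2 fun hc => hij ?_)
    exact e.symm.injective (Subtype.ext hc)

/-- The probability generating functional of a mixed Poisson process. -/
theorem integrable_and_pgf_eq [Nonempty E] [OpensMeasurableSpace E]
    (h : IsMixedPoisson P X M) {v : E → ℝ} (hv : Measurable v)
    (hv01 : ∀ x, v x ∈ Icc (0 : ℝ) 1) :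
    Integrable (fun ω => pointProduct v (X ω)) P ∧
    pgf P X v = ∫ ω, expNeg (∫⁻ x, ENNReal.ofReal (1 - v x) ∂(M ω)) ∂P := by
  obtain ⟨x₀⟩ := ‹Nonempty E›
  set u : E → ℝ≥0∞ := fun x => ENNReal.ofReal (1 - v x) with hu
  have hum : Measurable u := by fun_prop
  have hu1 : ∀ x, u x ≤ 1 := fun x =>
    ENNReal.ofReal_le_one.2 (by linarith [(hv01 x).1])
  have hB : ∀ n : ℕ, MeasurableSet (Metric.closedBall x₀ (n : ℝ)) := fun n =>
    Metric.isClosed_closedBall.measurableSet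
  -- Cutting off to growing balls makes the supports bounded while `f n` still increases to `u = 1 -
  -- v`.
  set f : ℕ → SimpleFunc E ℝ≥0∞ := fun n =>
    (SimpleFunc.eapprox u n).restrict (Metric.closedBall x₀ n) with hf
  have hfa : ∀ n x, f n x = (Metric.closedBall x₀ (n : ℝ)).indicator (SimpleFunc.eapprox u n) x :=
    fun n x => SimpleFunc.restrict_apply _ (hB n) x
  have hfb : ∀ n, Bornology.IsBounded (Function.support (f n)) := fun n =>
    Metric.isBounded_closedBall.subset fun x hx => by
      by_contra hx'
      exact hx (by rw [hfa, indicator_of_notMem hx'])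
  have hmono : Monotone fun n x => f n x := fun m n hmn x => by
    simp only [hfa]
    exact (indicator_le_indicator (SimpleFunc.monotone_eapprox u hmn x)).trans
      (indicator_le_indicator_of_subset (Metric.closedBall_subset_closedBall (by exact_mod_cast hmn))
        (fun _ => zero_le) x)
  have hlim : ∀ x, Tendsto (fun n => f n x) atTop (𝓝 (u x)) := fun x => by
    refine (SimpleFunc.tendsto_eapprox hum x).congr' ?_
    obtain ⟨N, hN⟩ := exists_nat_ge (dist x x₀)
    filter_upwards [eventually_ge_atTop N] with n hn
    rw [hfa, indicator_of_mem]
    exact Metric.mem_closedBall.2 (hN.trans (by exact_mod_cast hn))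
  have hfu : ∀ n x, f n x ≤ u x := fun n x =>
    Monotone.ge_of_tendsto (fun i j hij => hmono hij x) (hlim x) n
  have hf1 : ∀ n x, f n x ≤ 1 := fun n x => (hfu n x).trans (hu1 x)
  have hutop : ∀ x, u x ≠ ∞ := fun x => ENNReal.ofReal_ne_top
  have hvu : ∀ x, v x = 1 - (u x).toReal := fun x => by
    rw [hu, ENNReal.toReal_ofReal (by linarith [(hv01 x).2])]
    ring
  have hvn01 : ∀ n x, 1 - (f n x).toReal ∈ Icc (0 : ℝ) 1 := fun n x => by
    have := ENNReal.toReal_mono ENNReal.one_ne_top (hf1 n x)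
    rw [ENNReal.toReal_one] at this
    exact ⟨by linarith, by linarith [(f n x).toReal_nonneg]⟩
  have hpp : ∀ ω, Tendsto (fun n => pointProduct (fun x => 1 - (f n x).toReal) (X ω)) atTop
      (𝓝 (pointProduct v (X ω))) := fun ω => by
    refine tendsto_pointProduct (X ω) hvn01 hv01 (fun n x => ?_) fun x => ?_
    · rw [hvu]
      linarith [ENNReal.toReal_mono (hutop x) (hfu n x)]
    · rw [hvu]
      exact ((ENNReal.tendsto_toReal (hutop x)).comp (hlim x)).const_sub 1
  have hexp : ∀ ω, Tendsto (fun n => expNeg (∫⁻ x, f n x ∂(M ω))) atTop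
      (𝓝 (expNeg (∫⁻ x, u x ∂(M ω)))) := fun ω => by
    refine (continuous_expNeg.tendsto _).comp (lintegral_tendsto_of_tendsto_of_monotone
      (fun n => (f n).measurable.aemeasurable) (ae_of_all _ fun x => fun i j hij => hmono hij x)
      (ae_of_all _ hlim))
  have hnorm : ∀ {r : ℝ}, r ∈ Icc (0 : ℝ) 1 → ‖r‖ ≤ 1 := fun hr => by
    rw [Real.norm_of_nonneg hr.1]
    exact hr.2
  have key := fun n => h.pgf_simpleFunc (f n) (hf1 n) (hfb n)
  refine ⟨Integrable.of_bound (C := 1)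
    (aestronglyMeasurable_of_tendsto_ae atTop (fun n => (key n).1) (ae_of_all _ hpp))
    (ae_of_all _ fun ω => hnorm (pointProduct_mem_Icc _ hv01)), ?_⟩
  have t1 : Tendsto (fun n => pgf P X fun x => 1 - (f n x).toReal) atTop (𝓝 (pgf P X v)) :=
    tendsto_integral_of_dominated_convergence (fun _ => 1) (fun n => (key n).1)
      (integrable_const 1) (fun n => ae_of_all _ fun ω => hnorm (pointProduct_mem_Icc _ (hvn01 n)))
      (ae_of_all _ hpp)
  have t2 : Tendsto (fun n => ∫ ω, expNeg (∫⁻ x, f n x ∂(M ω)) ∂P) atTop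
      (𝓝 (∫ ω, expNeg (∫⁻ x, u x ∂(M ω)) ∂P)) :=
    tendsto_integral_of_dominated_convergence (fun _ => 1) (fun n => (key n).2.1)
      (integrable_const 1) (fun n => ae_of_all _ fun ω => hnorm (expNeg_mem_Icc _))
      (ae_of_all _ hexp)
  exact tendsto_nhds_unique t1 (t2.congr fun n => (key n).2.2.symm)

end IsMixedPoisson

/-! ### Integrals over lines -/

theorem norm_linePoint (ℓ : ℝ × ℝ) (t : ℝ) : ‖linePoint ℓ t‖ = √(ℓ.2 ^ 2 + t ^ 2) := by
  rw [EuclideanSpace.norm_eq]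
  congr 1
  simp only [linePoint, Fin.sum_univ_two, Real.norm_eq_abs, sq_abs]
  simp
  linear_combination (ℓ.2 ^ 2 + t ^ 2) * Real.sin_sq_add_cos_sq ℓ.1

theorem lintegral_eq_two_mul_lintegral_Ioi {f : ℝ → ℝ≥0∞} (hf : ∀ x, f (-x) = f x) :
    ∫⁻ x, f x = 2 * ∫⁻ x in Ioi 0, f x := by
  have h : ∫⁻ x in Iio 0, f x = ∫⁻ x in Ioi 0, f x := by
    have := (Measure.measurePreserving_neg (volume : Measure ℝ)).setLIntegral_comp_preimage_emb
      (MeasurableEquiv.neg ℝ).measurableEmbedding f (Ioi 0)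
    simpa [hf] using this
  rw [← lintegral_add_compl f (measurableSet_Ioi (a := (0 : ℝ))), compl_Ioi,
    setLIntegral_congr Iio_ae_eq_Iic.symm, h, two_mul]

theorem lintegral_lengthMeasure {f : Plane → ℝ≥0∞} (hf : Measurable f) (ℓ : ℝ × ℝ) :
    ∫⁻ x, f x ∂(lengthMeasure ℓ) = ∫⁻ t, f (linePoint ℓ t) :=
  lintegral_map hf (continuous_linePoint ℓ).measurable

theorem lintegral_lineParameters {f : ℝ → ℝ≥0∞} (hf : Measurable f) :
    ∫⁻ ℓ : ℝ × ℝ, f ℓ.2 ∂(volume.restrict (Ico 0 Real.pi ×ˢ univ)) =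
      ENNReal.ofReal Real.pi * ∫⁻ p, f p := by
  rw [Measure.volume_eq_prod, ← Measure.prod_restrict, lintegral_prod _ (by fun_prop)]
  simp [mul_comm]

end

end LineCox

/-! ### The generating functional of the line Cox process -/

theorem mainTheorem5 {Ω : Type*} [MeasurableSpace Ω] (P : MeasureTheory.Measure Ω)
    [MeasureTheory.IsProbabilityMeasure P] (lamR lamS : ℝ≥0)
    (R : Ω → Set (ℝ × ℝ)) (S : Ω → Set LineCox.Plane)
    (hR : LineCox.IsPoissonLineProcess P R lamR)
    (hS : LineCox.IsPoissonOnLines P R S lamS)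
    (ν : ℝ → ℝ) (hν : Measurable ν) (hν01 : ∀ r, 0 ≤ r → ν r ∈ Set.Icc (0 : ℝ) 1) :
    MeasureTheory.Integrable
        (fun ω => LineCox.pointProduct (fun x : LineCox.Plane => ν ‖x‖) (S ω)) P ∧
      LineCox.pgf P S (fun x : LineCox.Plane => ν ‖x‖) =
        LineCox.expNeg (2 * ENNReal.ofReal Real.pi * lamR *
          ∫⁻ r in Set.Ioi (0 : ℝ), ENNReal.ofReal (1 - LineCox.expNeg (2 * lamS *
            ∫⁻ t in Set.Ioi (0 : ℝ), ENNReal.ofReal (1 - ν (Real.sqrt (r ^ 2 + t ^ 2)))))) := by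
  open LineCox in
  have hv : Measurable fun x : Plane => ν ‖x‖ := hν.comp measurable_norm
  obtain ⟨hint, hpgf⟩ := (hS.isMixedPoisson hR.generatedBy_le).integrable_and_pgf_eq hv
    fun x => hν01 _ (norm_nonneg x)
  refine ⟨hint, hpgf.trans ?_⟩
  set H : ℝ → ℝ≥0∞ := fun r => 2 * lamS *
    ∫⁻ t in Set.Ioi (0 : ℝ), ENNReal.ofReal (1 - ν (Real.sqrt (r ^ 2 + t ^ 2))) with hH
  have hHm : Measurable H := by
    refine Measurable.const_mul (Measurable.lintegral_prod_right' (f := fun z : ℝ × ℝ =>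
      ENNReal.ofReal (1 - ν (Real.sqrt (z.1 ^ 2 + z.2 ^ 2)))) ?_) _
    have : Measurable fun z : ℝ × ℝ => Real.sqrt (z.1 ^ 2 + z.2 ^ 2) := by fun_prop
    have := hν.comp this
    fun_prop
  have hline : ∀ ℓ : ℝ × ℝ, lamS * ∫⁻ x, ENNReal.ofReal (1 - ν ‖x‖) ∂(lengthMeasure ℓ) = H ℓ.2 := by
    intro ℓ
    rw [lintegral_lengthMeasure (by fun_prop)]
    simp_rw [norm_linePoint]
    rw [lintegral_eq_two_mul_lintegral_Ioi fun t => by simp, ← mul_assoc, mul_comm (lamS : ℝ≥0∞)]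
  -- The integral against the sum of length measures is a sum over lines, which `expNeg` turns into
  -- a product over the points of `R`.
  have hcox : ∀ ω, expNeg (∫⁻ x, ENNReal.ofReal (1 - ν ‖x‖)
      ∂(lamS • Measure.sum fun ℓ : R ω => lengthMeasure (ℓ : ℝ × ℝ))) =
      pointProduct (fun ℓ => expNeg (H ℓ.2)) (R ω) := by
    intro ω
    rw [pointProduct, ← expNeg_tsum, lintegral_smul_measure, lintegral_sum_measure]
    simp_rw [← hline, ENNReal.tsum_mul_left]
    rfl
  simp_rw [hcox]
  have hg : Measurable fun ℓ : ℝ × ℝ => expNeg (H ℓ.2) :=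
    continuous_expNeg.measurable.comp (hHm.comp measurable_snd)
  have hR' := (hR.isMixedPoisson.integrable_and_pgf_eq hg fun ℓ => expNeg_mem_Icc _).2
  rw [pgf] at hR'
  rw [hR', integral_const, probReal_univ, one_smul, lintegral_smul_measure,
    lintegral_lineParameters (f := fun r => ENNReal.ofReal (1 - expNeg (H r)))
      (by have := continuous_expNeg.measurable.comp hHm; fun_prop),
    lintegral_eq_two_mul_lintegral_Ioi fun r => by simp [hH]]
  congr 1
  rw [ENNReal.smul_def, smul_eq_mul]
  ring
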